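/- Let $k$ be a field, let $N$ be a lattice of finite rank with dual lattice $M=\operatorname{Hom}(N,\mathbb{Z})$, and let $\Sigma$ be a fan in $N$, i.e. a finite non-empty collection of strongly convex cones (a cone being a finitely generated saturated additive submonoid of $N$) that is closed under taking faces and in which any two cones intersect in a common face. Let $\mathbb{T}_N=\operatorname{Spec} k[M]$ be the split torus and let $X_\Sigma$ be the associated split toric variety over $k$, i.e. the scheme obtained by gluing the affine schemes $U_\sigma=\operatorname{Spec} k[\sigma^\vee]$, $\sigma\in\Sigma$, where $\sigma^\vee=\{u\in M : u(v)\ge 0 \text{ for all } v\in\sigma\}$, with the action of $\mathbb{T}_N$ given on $U_\sigma$ by $\chi^u\mapsto\chi^u\otimes\chi^u$. Let $\operatorname{Aut}_\Sigma$ be the group of automorphisms of the lattice $N$ that preserve $\Sigma$. One says that $X_\Sigma$ has a torus factor if there are a lattice $N_1\neq 0$, a lattice $N_2$, a fan $\Sigma_2$ in $N_2$, an isomorphism of algebraic groups $\varphi:\mathbb{T}_N\cong\mathbb{T}_{N_1}\times\mathbb{T}_{N_2}$ over $k$ and a $\varphi$-equivariant isomorphism $X_\Sigma\cong\mathbb{T}_{N_1}\times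 X_{\Sigma_2}$ over $k$. Assume that $X_\Sigma$ is not the one-dimensional torus, i.e. it is not the case that $N$ has rank $1$ and $\Sigma=\{\{0\}\}$. Then $X_\Sigma$ has no torus factor if and only if $\operatorname{Aut}_\Sigma$ is a finite group. -/

import Mathlib

open CategoryTheory AlgebraicGeometry MonoidalCategory Limits
  CartesianMonoidalCategory
open scoped TensorProduct

universe u

namespace Toric

section Fans

variable {N : Type u} [AddCommGroup N]

/-- A cone in the lattice `N`: a finitely generated saturated additive submonoid of `N`. These are
exactly the sets of lattice points of rational polyhedral cones. -/
structure IsCone (σ : AddSubmonoid N) : Prop where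
  fg : σ.FG
  saturated : ∀ (n : ℕ) (x : N), 0 < n → n • x ∈ σ → x ∈ σ

/-- The dual cone `σ^∨ = {u ∈ M | u(v) ≥ 0 for all v ∈ σ}` in the dual lattice `M = Hom(N, ℤ)`. -/
def dualCone (σ : AddSubmonoid N) : AddSubmonoid (Module.Dual ℤ N) where
  carrier := {u | ∀ v ∈ σ, 0 ≤ u v}
  zero_mem' := fun _ _ => le_rfl
  add_mem' := fun ha hb v hv => add_nonneg (ha v hv) (hb v hv)

/-- `τ` is a face of `σ` if `τ = σ ∩ u^⊥` for some `u ∈ σ^∨`. -/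
def IsFace (τ σ : AddSubmonoid N) : Prop :=
  ∃ u ∈ dualCone σ, ∀ x, x ∈ τ ↔ x ∈ σ ∧ u x = 0

variable (N) in
/-- A fan in the lattice `N`: a finite (non-empty) collection of strongly convex cones which is
closed under taking faces and in which any two cones intersect in a common face. -/
structure Fan where
  cones : Set (AddSubmonoid N)
  finite : cones.Finite
  nonempty : cones.Nonempty
  isCone : ∀ σ ∈ cones, IsCone σ
  stronglyConvex : ∀ σ ∈ cones, IsFace ⊥ σ
  face_mem : ∀ σ ∈ cones, ∀ τ, IsFace τ σ → τ ∈ cones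
  inter_isFace : ∀ σ ∈ cones, ∀ τ ∈ cones, IsFace (σ ⊓ τ) σ ∧ IsFace (σ ⊓ τ) τ

/-- `Aut_Σ`: the group of automorphisms of the lattice `N` which preserve the fan `Σ`, that is,
which map the collection of cones of `Σ` onto itself. -/
def Fan.aut (F : Fan N) : Subgroup (N ≃ₗ[ℤ] N) where
  carrier := {A | ∀ σ : AddSubmonoid N, σ.map A ∈ F.cones ↔ σ ∈ F.cones}
  one_mem' := fun σ => by
    rw [show σ.map (1 : N ≃ₗ[ℤ] N) = σ from AddSubmonoid.map_id σ]
  mul_mem' := fun {A B} hA hB σ => by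
    rw [show σ.map (A * B) = (σ.map B).map A from SetLike.coe_injective <| by
      simp only [AddSubmonoid.coe_map, Set.image_image]; rfl]
    exact (hA _).trans (hB σ)
  inv_mem' := fun {A} hA σ => by
    rw [← hA, show (σ.map A⁻¹).map A = σ from SetLike.coe_injective <| by
      simp only [AddSubmonoid.coe_map, Set.image_image]
      exact (Set.image_congr fun x _ => A.apply_symm_apply x).trans (Set.image_id' _)]

lemma dualCone_anti {τ σ : AddSubmonoid N} (h : τ ≤ σ) : dualCone σ ≤ dualCone τ :=
  fun _ hu v hv => hu v (h hv)

lemma Fan.isFace_of_le (F : Fan N) {τ σ : AddSubmonoid N} (hτ : τ ∈ F.cones) (hσ : σ ∈ F.cones)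
    (h : τ ≤ σ) : IsFace τ σ := by
  have := (F.inter_isFace τ hτ σ hσ).2
  rwa [inf_eq_left.mpr h] at this

/-- If `τ = σ ∩ u^⊥` with `σ` finitely generated, then `τ^∨ = σ^∨ + ℕ (-u)`. -/
lemma exists_add_nsmul_mem {τ σ : AddSubmonoid N} (hσ : σ.FG) {u : Module.Dual ℤ N}
    (hu : u ∈ dualCone σ) (hτ : ∀ x, x ∈ τ ↔ x ∈ σ ∧ u x = 0) {w : Module.Dual ℤ N}
    (hw : w ∈ dualCone τ) : ∃ n : ℕ, w + n • u ∈ dualCone σ := by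
  obtain ⟨S, rfl⟩ := hσ
  refine ⟨∑ x ∈ S, (w x).natAbs, fun v hv => ?_⟩
  induction hv using AddSubmonoid.closure_induction with
  | mem x hx =>
    have hxσ := AddSubmonoid.subset_closure hx
    have h0 : 0 ≤ u x := hu x hxσ
    simp only [LinearMap.add_apply, LinearMap.smul_apply]
    rcases h0.eq_or_lt with h | h
    · rw [← h, smul_zero, add_zero]
      exact hw x ((hτ x).2 ⟨hxσ, h.symm⟩)
    · have h1 : (w x).natAbs ≤ ∑ x ∈ S, (w x).natAbs :=
        Finset.single_le_sum (f := fun x => (w x).natAbs) (fun _ _ => Nat.zero_le _) hx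
      rw [nsmul_eq_mul]
      have h2 : ((w x).natAbs : ℤ) ≤ ((∑ x ∈ S, (w x).natAbs : ℕ) : ℤ) := by exact_mod_cast h1
      have h3 : -(w x) ≤ ((w x).natAbs : ℤ) := by omega
      nlinarith
  | zero => simp
  | add x y _ _ hx hy => rw [map_add]; exact add_nonneg hx hy

end Fans

noncomputable section Varieties

variable (k : Type u) [Field k] {N : Type u} [AddCommGroup N]

/-- The base scheme `Spec k`. -/
abbrev base : Scheme.{u} := Spec (.of k)

/-- The affine scheme `Spec A` over `Spec k` for a `k`-algebra `A`. -/
abbrev specOver (A : Type u) [CommRing A] [Algebra k A] : Over (base k) :=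
  (Spec (.of A)).asOver (base k)

section Spec

variable {k} {A B C : Type u} [CommRing A] [Algebra k A] [CommRing B] [Algebra k B]
  [CommRing C] [Algebra k C]

/-- The morphism `Spec B → Spec A` over `k` given by a `k`-algebra homomorphism `A → B`. -/
def specMap (f : A →ₐ[k] B) : specOver k B ⟶ specOver k A :=
  (Spec.map (CommRingCat.ofHom f.toRingHom)).asOver (base k)

lemma specMap_id : specMap (AlgHom.id k A) = 𝟙 _ := by
  ext1
  exact Spec.map_id _

lemma specMap_comp (f : A →ₐ[k] B) (g : B →ₐ[k] C) :
    specMap g ≫ specMap f = specMap (g.comp f) := by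
  ext1
  exact (Spec.map_comp _ _).symm

variable (A B) in
/-- The isomorphism `Spec A × Spec B ≅ Spec (A ⊗ B)` over `k`. -/
def specProdIso : specOver k A ⊗ specOver k B ≅ specOver k (A ⊗[k] B) :=
  (Over.isoMk (pullbackSpecIso' k A B).symm
    ((pullbackSpecIso_inv_fst_assoc k A B (Spec.map (CommRingCat.ofHom (algebraMap k A)))).trans
      (Spec.map_comp _ _).symm)).symm

lemma specProdIso_inv_fst : (specProdIso (k := k) A B).inv ≫ fst _ _ =
    specMap Algebra.TensorProduct.includeLeft := by
  ext1
  exact pullbackSpecIso_inv_fst k A B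

lemma specProdIso_inv_snd : (specProdIso (k := k) A B).inv ≫ snd _ _ =
    specMap Algebra.TensorProduct.includeRight := by
  ext1
  exact pullbackSpecIso_inv_snd k A B

lemma whiskerLeft_specMap (f : B →ₐ[k] C) :
    specOver k A ◁ specMap f ≫ (specProdIso A B).hom =
      (specProdIso A C).hom ≫ specMap (Algebra.TensorProduct.map (AlgHom.id k A) f) := by
  rw [← Iso.inv_comp_eq, ← Category.assoc, ← Iso.eq_comp_inv]
  ext1
  · rw [Category.assoc, whiskerLeft_fst, Category.assoc, specProdIso_inv_fst,
      specProdIso_inv_fst, specMap_comp]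
    congr 1
    ext
    simp
  · rw [Category.assoc, whiskerLeft_snd, Category.assoc, specProdIso_inv_snd,
      ← Category.assoc, specProdIso_inv_snd, specMap_comp, specMap_comp]
    congr 1

end Spec

variable (N) in
/-- The split torus `𝕋_N = Spec k[M]`, `M = Hom(N, ℤ)`, as a scheme over `k`. It is a group scheme
through the Hopf algebra structure of the group algebra `k[M]`. -/
abbrev torus : Over (base k) := specOver k (AddMonoidAlgebra k (Module.Dual ℤ N))

/-- The affine toric variety `U_σ = Spec k[σ^∨]`. -/
abbrev chart (σ : AddSubmonoid N) : Over (base k) := specOver k (AddMonoidAlgebra k (dualCone σ))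

lemma algHom_ext_single {S : Type u} [AddMonoid S] {B : Type u} [Semiring B] [Algebra k B]
    {f g : AddMonoidAlgebra k S →ₐ[k] B}
    (h : ∀ m, f (AddMonoidAlgebra.single m 1) = g (AddMonoidAlgebra.single m 1)) : f = g :=
  (AddMonoidAlgebra.lift k B S).symm.injective (MonoidHom.ext fun m => h m.toAdd)

/-- The inclusion of semigroup algebras `k[σ^∨] → k[τ^∨]` for `τ ⊆ σ`. -/
def restrict {τ σ : AddSubmonoid N} (h : τ ≤ σ) :
    AddMonoidAlgebra k (dualCone σ) →ₐ[k] AddMonoidAlgebra k (dualCone τ) :=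
  AddMonoidAlgebra.mapDomainAlgHom k k (AddSubmonoid.inclusion (dualCone_anti h))

@[simp] lemma restrict_single {τ σ : AddSubmonoid N} (h : τ ≤ σ) (m : dualCone σ) (a : k) :
    restrict k h (AddMonoidAlgebra.single m a) =
      AddMonoidAlgebra.single (AddSubmonoid.inclusion (dualCone_anti h) m) a := by
  simp [restrict]

/-- The morphism `U_τ → U_σ` for `τ ⊆ σ`. -/
def chartMap {τ σ : AddSubmonoid N} (h : τ ≤ σ) : chart k τ ⟶ chart k σ :=
  specMap (restrict k h)

/-- The coaction `k[σ^∨] → k[M] ⊗ k[σ^∨]`, `χ^u ↦ χ^u ⊗ χ^u`. -/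
def coaction (σ : AddSubmonoid N) :
    AddMonoidAlgebra k (dualCone σ) →ₐ[k]
      AddMonoidAlgebra k (Module.Dual ℤ N) ⊗[k] AddMonoidAlgebra k (dualCone σ) :=
  AddMonoidAlgebra.lift k _ _
    { toFun := fun m => AddMonoidAlgebra.single (m.toAdd : Module.Dual ℤ N) (1 : k) ⊗ₜ[k]
        AddMonoidAlgebra.single m.toAdd (1 : k)
      map_one' := rfl
      map_mul' := fun a b => by
        simp [Algebra.TensorProduct.tmul_mul_tmul, AddMonoidAlgebra.single_mul_single] }

lemma isLocalization_restrict {τ σ : AddSubmonoid N} (h : τ ≤ σ) (hσ : σ.FG) (u : dualCone σ)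
    (hτ : ∀ x, x ∈ τ ↔ x ∈ σ ∧ (u : Module.Dual ℤ N) x = 0) :
    letI := (restrict k h).toRingHom.toAlgebra
    IsLocalization.Away (AddMonoidAlgebra.single u (1 : k) : AddMonoidAlgebra k (dualCone σ))
      (AddMonoidAlgebra k (dualCone τ)) := by
  let := (restrict k h).toRingHom.toAlgebra
  have hmap : ∀ x, algebraMap (AddMonoidAlgebra k (dualCone σ))
      (AddMonoidAlgebra k (dualCone τ)) x = restrict k h x := fun _ => rfl
  have hinj : Function.Injective (restrict k h) :=
    AddMonoidAlgebra.mapDomain_injective (AddSubmonoid.inclusion_injective (dualCone_anti h))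
  refine ⟨?_, ?_, ?_⟩
  · rintro ⟨_, n, rfl⟩
    rw [map_pow]
    refine IsUnit.pow _ (IsUnit.of_mul_eq_one (AddMonoidAlgebra.single
      (⟨-u, fun v hv => by simp [((hτ v).1 hv).2]⟩ : dualCone τ) (1 : k)) ?_)
    rw [hmap, restrict_single, AddMonoidAlgebra.single_mul_single, AddMonoidAlgebra.one_def]
    congr 1
    · ext1; simp
    · simp
  · intro f
    suffices H : ∃ (n : ℕ) (g : AddMonoidAlgebra k (dualCone σ)),
        f * restrict k h (AddMonoidAlgebra.single u (1 : k)) ^ n = restrict k h g by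
      obtain ⟨n, g, hg⟩ := H
      exact ⟨(g, ⟨_, n, rfl⟩), by rw [hmap, hmap, map_pow]; exact hg⟩
    induction f using AddMonoidAlgebra.induction_linear with
    | zero => exact ⟨0, 0, by simp⟩
    | add f g hf hg =>
      obtain ⟨n, f', hf⟩ := hf
      obtain ⟨m, g', hg⟩ := hg
      refine ⟨n + m, f' * AddMonoidAlgebra.single u (1 : k) ^ m +
        g' * AddMonoidAlgebra.single u (1 : k) ^ n, ?_⟩
      rw [map_add, map_mul, map_mul, map_pow, map_pow, ← hf, ← hg]
      ring
    | single w a =>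
      obtain ⟨n, hn⟩ := exists_add_nsmul_mem hσ u.2 hτ w.2
      refine ⟨n, AddMonoidAlgebra.single ⟨_, hn⟩ a, ?_⟩
      rw [restrict_single, AddMonoidAlgebra.single_pow, AddMonoidAlgebra.single_mul_single,
        restrict_single]
      congr 1
      simp
  · intro x y hxy
    exact ⟨1, by rw [hinj hxy]⟩

lemma isOpenImmersion_chartMap {τ σ : AddSubmonoid N} (h : τ ≤ σ) (hσ : σ.FG)
    (hf : IsFace τ σ) : IsOpenImmersion (chartMap k h).left := by
  obtain ⟨u, hu, hτ⟩ := hf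
  let := (restrict k h).toRingHom.toAlgebra
  have := isLocalization_restrict k h hσ ⟨u, hu⟩ hτ
  exact IsOpenImmersion.of_isLocalization
    (AddMonoidAlgebra.single (⟨u, hu⟩ : dualCone σ) (1 : k))

lemma range_chartMap {τ σ : AddSubmonoid N} (h : τ ≤ σ) (hσ : σ.FG) (u : dualCone σ)
    (hτ : ∀ x, x ∈ τ ↔ x ∈ σ ∧ (u : Module.Dual ℤ N) x = 0) :
    Set.range (chartMap k h).left = (PrimeSpectrum.basicOpen
      (AddMonoidAlgebra.single u (1 : k) : AddMonoidAlgebra k (dualCone σ)) :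
        Set (PrimeSpectrum (AddMonoidAlgebra k (dualCone σ)))) := by
  let := (restrict k h).toRingHom.toAlgebra
  have := isLocalization_restrict k h hσ u hτ
  exact PrimeSpectrum.localization_away_comap_range _
    (AddMonoidAlgebra.single u (1 : k))

lemma chartMap_refl (σ : AddSubmonoid N) : chartMap k (le_refl σ) = 𝟙 _ := by
  rw [← specMap_id]
  refine congrArg specMap (algHom_ext_single k fun m => ?_)
  rw [restrict_single]
  rfl

lemma chartMap_comp {ρ τ σ : AddSubmonoid N} (h : ρ ≤ τ) (h' : τ ≤ σ) :
    chartMap k h ≫ chartMap k h' = chartMap k (h.trans h') := by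
  refine (specMap_comp _ _).trans (congrArg specMap (algHom_ext_single k fun m => ?_))
  rw [AlgHom.comp_apply, restrict_single, restrict_single, restrict_single]
  rfl

/-- The diagram of the affine toric varieties `U_σ`, `σ ∈ Σ`, with the open immersions `U_τ → U_σ`
for the faces `τ` of `σ`. -/
def diagram (F : Fan N) : F.cones ⥤ Over (base k) where
  obj σ := chart k σ.1
  map f := chartMap k (leOfHom f)
  map_id σ := chartMap_refl k σ.1
  map_comp f g := (chartMap_comp k (leOfHom f) (leOfHom g)).symm

/-- The underlying diagram of schemes. -/
abbrev schemeDiagram (F : Fan N) : F.cones ⥤ Scheme.{u} := diagram k F ⋙ Over.forget _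

instance instIsOpenImmersionMap (F : Fan N) {τ σ : F.cones} (f : τ ⟶ σ) :
    IsOpenImmersion ((schemeDiagram k F).map f) :=
  isOpenImmersion_chartMap k _ (F.isCone _ σ.2).fg (F.isFace_of_le τ.2 σ.2 (leOfHom f))

instance (F : Fan N) : (schemeDiagram k F ⋙ Scheme.forget).IsLocallyDirected where
  cond {τ₁ τ₂ σ} f₁ f₂ x₁ x₂ hx := by
    replace hx : (chartMap k (leOfHom f₁)).left x₁ = (chartMap k (leOfHom f₂)).left x₂ := hx
    obtain ⟨u₁, hu₁, h₁⟩ := F.isFace_of_le τ₁.2 σ.2 (leOfHom f₁)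
    obtain ⟨u₂, hu₂, h₂⟩ := F.isFace_of_le τ₂.2 σ.2 (leOfHom f₂)
    have hfg := (F.isCone _ σ.2).fg
    have hρ : τ₁.1 ⊓ τ₂.1 ∈ F.cones := F.face_mem _ τ₁.2 _ (F.inter_isFace _ τ₁.2 _ τ₂.2).1
    have hface : ∀ x, x ∈ τ₁.1 ⊓ τ₂.1 ↔ x ∈ σ.1 ∧ (u₁ + u₂) x = 0 := by
      intro x
      rw [AddSubmonoid.mem_inf, h₁, h₂, LinearMap.add_apply]
      constructor
      · rintro ⟨⟨h, h'⟩, -, h''⟩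
        exact ⟨h, by rw [h', h'', add_zero]⟩
      · rintro ⟨h, h'⟩
        have a := hu₁ x h
        have b := hu₂ x h
        exact ⟨⟨h, by omega⟩, h, by omega⟩
    have r₁ := range_chartMap k (leOfHom f₁) hfg ⟨u₁, hu₁⟩ h₁
    have r₂ := range_chartMap k (leOfHom f₂) hfg ⟨u₂, hu₂⟩ h₂
    have r := range_chartMap k (inf_le_left.trans (leOfHom f₁)) hfg
      (⟨u₁, hu₁⟩ + ⟨u₂, hu₂⟩ : dualCone σ.1) hface
    have e : (AddMonoidAlgebra.single (⟨u₁, hu₁⟩ + ⟨u₂, hu₂⟩ : dualCone σ.1) (1 : k)) =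
        AddMonoidAlgebra.single ⟨u₁, hu₁⟩ 1 * AddMonoidAlgebra.single ⟨u₂, hu₂⟩ 1 := by
      rw [AddMonoidAlgebra.single_mul_single, one_mul]
    have hy : (chartMap k (leOfHom f₁)).left x₁ ∈
        Set.range (chartMap k (inf_le_left.trans (leOfHom f₁) : τ₁.1 ⊓ τ₂.1 ≤ σ.1)).left := by
      rw [r, e, PrimeSpectrum.basicOpen_mul]
      exact ⟨r₁ ▸ ⟨x₁, rfl⟩, r₂ ▸ ⟨x₂, hx.symm⟩⟩
    obtain ⟨y, hy⟩ := hy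
    have c₁ : (chartMap k (leOfHom f₁)).left ((chartMap k inf_le_left).left y) = _ :=
      congrArg (fun f : chart k (τ₁.1 ⊓ τ₂.1) ⟶ chart k σ.1 => f.left y)
        (chartMap_comp k inf_le_left (leOfHom f₁))
    have c₂ : (chartMap k (leOfHom f₂)).left ((chartMap k inf_le_right).left y) = _ :=
      congrArg (fun f : chart k (τ₁.1 ⊓ τ₂.1) ⟶ chart k σ.1 => f.left y)
        (chartMap_comp k inf_le_right (leOfHom f₂))
    let ρ : F.cones := ⟨_, hρ⟩
    have l₁ : ρ ≤ τ₁ := inf_le_left (a := τ₁.1)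
    have l₂ : ρ ≤ τ₂ := inf_le_right (a := τ₁.1)
    exact ⟨ρ, homOfLE l₁, homOfLE l₂, y,
      ((schemeDiagram k F).map f₁).isOpenEmbedding.injective (c₁.trans hy),
      ((schemeDiagram k F).map f₂).isOpenEmbedding.injective (c₂.trans (hy.trans hx))⟩

/-- The toric variety `X_Σ` over `k`: the gluing of the `U_σ` for `σ ∈ Σ` along the
open immersions `U_τ → U_σ` for the faces `τ` of `σ`. -/
def toricVariety (F : Fan N) : Over (base k) :=
  Over.mk (colimit.desc (schemeDiagram k F)
    ⟨base k, { app := fun σ => (chart k σ.1).hom, naturality := fun _ _ f =>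
      (Over.w ((diagram k F).map f)).trans (Category.comp_id _).symm }⟩)

/-- The open immersion `U_σ → X_Σ`. -/
def chartι (F : Fan N) (σ : F.cones) : chart k σ.1 ⟶ toricVariety k F :=
  Over.homMk (colimit.ι (schemeDiagram k F) σ) (colimit.ι_desc _ _)

lemma chartMap_chartι (F : Fan N) {τ σ : F.cones} (f : τ ⟶ σ) :
    chartMap k (leOfHom f) ≫ chartι k F σ = chartι k F τ := by
  ext1
  exact colimit.w (schemeDiagram k F) f

/-- The cover of `X_Σ` by the `U_σ`. -/
def chartCover (F : Fan N) : (toricVariety k F).left.OpenCover :=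
  Scheme.IsLocallyDirected.openCover (schemeDiagram k F)

instance (F : Fan N) : Category (chartCover k F).I₀ := inferInstanceAs (Category F.cones)

instance (F : Fan N) : Scheme.Cover.LocallyDirected (chartCover k F) where
  trans f := (schemeDiagram k F).map f
  trans_id σ := (schemeDiagram k F).map_id σ
  trans_comp f g := (schemeDiagram k F).map_comp f g
  w f := colimit.w (schemeDiagram k F) f
  directed {i j} x := by
    have hx : colimit.ι (schemeDiagram k F) i (pullback.fst ((chartCover k F).f i) _ x) =
        colimit.ι (schemeDiagram k F) j (pullback.snd _ ((chartCover k F).f j) x) :=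
      congrArg (fun f : pullback ((chartCover k F).f i) ((chartCover k F).f j) ⟶ _ => f x)
        pullback.condition
    obtain ⟨l, fi, fj, y, h₁, h₂⟩ := (Scheme.IsLocallyDirected.ι_eq_ι_iff _).1 hx
    refine ⟨l, fi, fj, y, ?_⟩
    apply (pullback.fst ((chartCover k F).f i) ((chartCover k F).f j)).isOpenEmbedding.injective
    exact (congrArg (fun f : (schemeDiagram k F).obj l ⟶ (chartCover k F).X i => f y)
      (pullback.lift_fst (f := (chartCover k F).f i) (g := (chartCover k F).f j)
        ((schemeDiagram k F).map fi) ((schemeDiagram k F).map fj) _)).trans h₁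
  property_trans {i j} f := by
    exact instIsOpenImmersionMap k F (τ := i) (σ := j) f

/-- The action `𝕋_N × U_σ → U_σ` given by the coaction `χ^u ↦ χ^u ⊗ χ^u`. -/
def chartAct (σ : AddSubmonoid N) : torus k N ⊗ chart k σ ⟶ chart k σ :=
  (specProdIso _ _).hom ≫ specMap (coaction k σ)

@[simp] lemma coaction_single (σ : AddSubmonoid N) (m : dualCone σ) :
    coaction k σ (AddMonoidAlgebra.single m 1) =
      AddMonoidAlgebra.single (m : Module.Dual ℤ N) (1 : k) ⊗ₜ AddMonoidAlgebra.single m 1 := by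
  simp [coaction]

lemma coaction_restrict {τ σ : AddSubmonoid N} (h : τ ≤ σ) :
    (Algebra.TensorProduct.map (AlgHom.id k _) (restrict k h)).comp (coaction k σ) =
      (coaction k τ).comp (restrict k h) := by
  refine algHom_ext_single k fun m => ?_
  rw [AlgHom.comp_apply, AlgHom.comp_apply, restrict_single, coaction_single, coaction_single,
    Algebra.TensorProduct.map_tmul, restrict_single]
  rfl

lemma whiskerLeft_chartMap_chartAct {τ σ : AddSubmonoid N} (h : τ ≤ σ) :
    torus k N ◁ chartMap k h ≫ chartAct k σ = chartAct k τ ≫ chartMap k h := by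
  rw [chartAct, chartAct, chartMap, ← Category.assoc, whiskerLeft_specMap, Category.assoc,
    Category.assoc, specMap_comp, specMap_comp, coaction_restrict]

/-- The open cover of `𝕋_N × X_Σ` by the preimages of the `U_σ`. -/
def prodCover (F : Fan N) : (torus k N ⊗ toricVariety k F).left.OpenCover :=
  (chartCover k F).pullback₁ (snd (torus k N) (toricVariety k F)).left

instance (F : Fan N) : Category (prodCover k F).I₀ := inferInstanceAs (Category F.cones)

instance (F : Fan N) : Scheme.Cover.LocallyDirected (prodCover k F) :=
  Scheme.Cover.locallyDirectedPullbackCover (chartCover k F) _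

/-- The preimage of `U_σ` in `𝕋_N × X_Σ`. -/
abbrev piece (F : Fan N) (σ : F.cones) : Scheme.{u} :=
  pullback (snd (torus k N) (toricVariety k F)).left (chartι k F σ).left

/-- The identification of the preimage of `U_σ` in `𝕋_N × X_Σ` with `𝕋_N × U_σ`. -/
def toPiece (F : Fan N) (σ : F.cones) : piece k F σ ⟶ (torus k N ⊗ chart k σ.1).left :=
  pullback.lift (pullback.fst _ _ ≫ (fst (torus k N) (toricVariety k F)).left)
    (pullback.snd _ _) (by
      rw [Category.assoc, Over.w, ← Over.w (chartι k F σ), ← pullback.condition_assoc, Over.w])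

lemma toPiece_fst (F : Fan N) (σ : F.cones) :
    toPiece k F σ ≫ (fst (torus k N) (chart k σ.1)).left =
      pullback.fst _ _ ≫ (fst (torus k N) (toricVariety k F)).left :=
  pullback.lift_fst _ _ _

lemma toPiece_snd (F : Fan N) (σ : F.cones) :
    toPiece k F σ ≫ (snd (torus k N) (chart k σ.1)).left = pullback.snd _ _ :=
  pullback.lift_snd _ _ _

lemma prod_hom_ext {Z : Scheme.{u}} {X Y : Over (base k)} (f g : Z ⟶ (X ⊗ Y).left)
    (h₁ : f ≫ (fst X Y).left = g ≫ (fst X Y).left)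
    (h₂ : f ≫ (snd X Y).left = g ≫ (snd X Y).left) : f = g :=
  Over.tensorObj_ext f g h₁ h₂

lemma toPiece_whiskerLeft (F : Fan N) (σ : F.cones) :
    toPiece k F σ ≫ (torus k N ◁ chartι k F σ).left = pullback.fst _ _ := by
  apply prod_hom_ext
  · rw [Category.assoc, ← Over.comp_left, whiskerLeft_fst, toPiece_fst]
  · rw [Category.assoc, ← Over.comp_left, whiskerLeft_snd, Over.comp_left, ← Category.assoc,
      toPiece_snd, pullback.condition]

/-- The inclusion of the preimage of `U_τ` into the preimage of `U_σ`. -/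
def pieceMap (F : Fan N) {τ σ : F.cones} (f : τ ⟶ σ) : piece k F τ ⟶ piece k F σ :=
  pullback.map _ _ _ _ (𝟙 _) (chartMap k (leOfHom f)).left (𝟙 _) (by simp) (by
    rw [← Over.comp_left, chartMap_chartι k F f, Category.comp_id])

lemma pieceMap_toPiece (F : Fan N) {τ σ : F.cones} (f : τ ⟶ σ) :
    pieceMap k F f ≫ toPiece k F σ =
      toPiece k F τ ≫ (torus k N ◁ chartMap k (leOfHom f)).left := by
  apply prod_hom_ext
  · rw [Category.assoc, Category.assoc, ← Over.comp_left, whiskerLeft_fst, toPiece_fst,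
      toPiece_fst, pieceMap, pullback.lift_fst_assoc, Category.comp_id]
  · rw [Category.assoc, Category.assoc, ← Over.comp_left, whiskerLeft_snd, Over.comp_left,
      toPiece_snd, ← Category.assoc, toPiece_snd, pieceMap, pullback.lift_snd]

/-- The action on the preimage of `U_σ`. -/
def pieceAct (F : Fan N) (σ : F.cones) : piece k F σ ⟶ (toricVariety k F).left :=
  toPiece k F σ ≫ (chartAct k σ.1 ≫ chartι k F σ).left

lemma pieceMap_pieceAct (F : Fan N) {τ σ : F.cones} (f : τ ⟶ σ) :
    pieceMap k F f ≫ pieceAct k F σ = pieceAct k F τ := by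
  rw [pieceAct, pieceAct, ← Category.assoc, pieceMap_toPiece, Category.assoc, ← Over.comp_left,
    ← Category.assoc, whiskerLeft_chartMap_chartAct, Category.assoc, chartMap_chartι k F f]

lemma pieceAct_hom (F : Fan N) (σ : F.cones) :
    pieceAct k F σ ≫ (toricVariety k F).hom =
      pullback.fst _ _ ≫ (torus k N ⊗ toricVariety k F).hom := by
  rw [pieceAct, Category.assoc, Over.w, ← Over.w (torus k N ◁ chartι k F σ), ← Category.assoc,
    toPiece_whiskerLeft]

/-- The action `𝕋_N × X_Σ → X_Σ` of the torus on the toric variety, glued from the actions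
`𝕋_N × U_σ → U_σ`. -/
def torusAct (F : Fan N) : torus k N ⊗ toricVariety k F ⟶ toricVariety k F :=
  Scheme.OpenCover.glueMorphismsOverOfLocallyDirected (prodCover k F)
    (fun σ => pieceAct k F σ) (fun f => pieceMap_pieceAct k F f) (fun σ => pieceAct_hom k F σ)

/-- The defining property of the action: it restricts to the given action on every `U_σ`. -/
lemma whiskerLeft_chartι_torusAct (F : Fan N) (σ : F.cones) :
    torus k N ◁ chartι k F σ ≫ torusAct k F = chartAct k σ.1 ≫ chartι k F σ := by
  let s : (torus k N ⊗ chart k σ.1).left ⟶ piece k F σ :=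
    pullback.lift (torus k N ◁ chartι k F σ).left (snd (torus k N) (chart k σ.1)).left (by
      rw [← Over.comp_left, whiskerLeft_snd]; rfl)
  have hs : s ≫ pullback.fst _ _ = (torus k N ◁ chartι k F σ).left := pullback.lift_fst _ _ _
  have hs' : s ≫ toPiece k F σ = 𝟙 _ := by
    apply prod_hom_ext
    · rw [Category.assoc, toPiece_fst, ← Category.assoc, hs, ← Over.comp_left, whiskerLeft_fst,
        Category.id_comp]
    · rw [Category.assoc, toPiece_snd, pullback.lift_snd, Category.id_comp]
  have hg : pullback.fst _ _ ≫ (torusAct k F).left = pieceAct k F σ :=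
    Scheme.OpenCover.map_glueMorphismsOverOfLocallyDirected_left (prodCover k F)
      (Y := toricVariety k F) (fun σ => pieceAct k F σ) _ _ σ
  ext1
  rw [Over.comp_left, ← hs, Category.assoc, hg, pieceAct, ← Category.assoc, hs', Category.id_comp]

/-- The action of `𝕋_{N₁} × 𝕋_{N₂}` on `𝕋_{N₁} × X_{Σ₂}`: the first factor acts on `𝕋_{N₁}` by
multiplication, the second one on `X_{Σ₂}`. -/
def prodAct (N₁ : Type u) [AddCommGroup N₁] {N₂ : Type u} [AddCommGroup N₂] (F₂ : Fan N₂) :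
    (torus k N₁ ⊗ torus k N₂) ⊗ (torus k N₁ ⊗ toricVariety k F₂) ⟶
      torus k N₁ ⊗ toricVariety k F₂ :=
  tensorμ _ _ _ _ ≫ (MonObj.mul ⊗ₘ torusAct k F₂)

/-- `X_Σ` has a torus factor: it is equivariantly isomorphic over `k` to the product
`𝕋_{N₁} × X_{Σ₂}` of a non-trivial split torus and a toric variety, along an isomorphism
`𝕋_N ≅ 𝕋_{N₁} × 𝕋_{N₂}` of group schemes. -/
def HasTorusFactor (F : Fan N) : Prop :=
  ∃ (N₁ N₂ : Type u) (_ : AddCommGroup N₁) (_ : AddCommGroup N₂)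
    (_ : Module.Free ℤ N₁) (_ : Module.Finite ℤ N₁)
    (_ : Module.Free ℤ N₂) (_ : Module.Finite ℤ N₂)
    (F₂ : Fan N₂) (φ : torus k N ≅ torus k N₁ ⊗ torus k N₂)
    (α : toricVariety k F ≅ torus k N₁ ⊗ toricVariety k F₂),
    Nontrivial N₁ ∧ IsMonHom φ.hom ∧ torusAct k F ≫ α.hom = (φ.hom ⊗ₘ α.hom) ≫ prodAct k N₁ F₂

end Varieties
end Toric

/-! Both properties are governed by the linear forms that vanish on every cone of `Σ`
(`Fan.IsNull`): each is equivalent to the absence of a non-zero null form.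

On the combinatorial side, the Hilbert bases of the cones form a finite set stable under `Aut_Σ`.
Without non-zero null forms, an automorphism is determined by its values on this set, so `Aut_Σ` is
finite (`Fan.finite_aut`). A null form `u ≠ 0` yields transvections `x ↦ x + n u(x) v` with `u(v) =
0` and `v ≠ 0`; they fix all cones pointwise, so `Aut_Σ` is infinite (`Fan.infinite_aut`). Such a
`v` is missing only if `u` is injective, which is the excluded case of the one-dimensional torus.

On the geometric side, the units of `k[M]` are monomials, and a monomial that is invertible on every
`U_σ` has a null exponent. Without non-zero null forms, every morphism from `X_Σ` to a split torus
is therefore constant (`toricVariety_hom_torus_constant`), whereas the projection to a non-trivial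
torus factor is not. Conversely, for a null form `u ≠ 0` the lattice splits as `N / ker u ⊕ ker u`
with all cones inside `ker u`; the resulting toric morphisms identify `X_Σ` equivariantly with a
product (`Splitting.toricVarietyIso`, `Splitting.torusAct_toricVarietyIso`). -/

namespace Toric

/-! ### Null forms and the automorphism group of a fan. -/

section Lattice

variable {N : Type u} [AddCommGroup N]

lemma exists_dual_apply_ne_zero [Module.Free ℤ N] {x : N} (hx : x ≠ 0) :
    ∃ f : Module.Dual ℤ N, f x ≠ 0 := by
  by_contra! h
  exact hx ((Module.forall_dual_apply_eq_zero_iff ℤ x).1 h)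

/-- The irreducible elements of an additive submonoid: for a strongly convex cone, its Hilbert
basis. -/
def hilbertBasis (σ : AddSubmonoid N) : Set N :=
  {x | x ∈ σ ∧ x ≠ 0 ∧ ∀ a ∈ σ, ∀ b ∈ σ, x = a + b → a = 0 ∨ b = 0}

/-- An irreducible element belongs to every generating set, in particular to a finite one. -/
lemma hilbertBasis_finite {σ : AddSubmonoid N} (hσ : σ.FG) : (hilbertBasis σ).Finite := by
  obtain ⟨S, rfl⟩ := hσ
  refine S.finite_toSet.subset fun x hx => ?_
  obtain ⟨hxσ, hx⟩ := hx
  induction hxσ using AddSubmonoid.closure_induction with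
  | mem x h => exact h
  | zero => exact absurd rfl hx.1
  | add x y hxσ hyσ ihx ihy =>
    rcases hx.2 x hxσ y hyσ rfl with rfl | rfl
    · rw [zero_add] at hx ⊢
      exact ihy hx
    · rw [add_zero] at hx ⊢
      exact ihx hx

/-- Strong convexity provides a form `u` that is positive on the non-zero elements of `σ`. Both
summands of a non-trivial decomposition then have smaller `u`-value, so induction on this value
applies. -/
lemma closure_hilbertBasis {σ : AddSubmonoid N} (hσ : IsFace ⊥ σ) :
    AddSubmonoid.closure (hilbertBasis σ) = σ := by
  refine le_antisymm (AddSubmonoid.closure_le.2 fun x hx => hx.1) ?_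
  obtain ⟨u, hu, h⟩ := hσ
  have key : ∀ (n : ℕ) (x : N), x ∈ σ → (u x).toNat = n →
      x ∈ AddSubmonoid.closure (hilbertBasis σ) := by
    intro n
    induction n using Nat.strong_induction_on with
    | _ n ih =>
      intro x hx hn
      by_cases h0 : x = 0
      · exact h0 ▸ zero_mem _
      by_cases hirr : ∀ a ∈ σ, ∀ b ∈ σ, x = a + b → a = 0 ∨ b = 0
      · exact AddSubmonoid.subset_closure ⟨hx, h0, hirr⟩
      push Not at hirr
      obtain ⟨a, ha, b, hb, rfl, ha0, hb0⟩ := hirr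
      have pos : ∀ c ∈ σ, c ≠ 0 → 0 < u c := fun c hc hc0 =>
        lt_of_le_of_ne (hu c hc) fun e => hc0 ((h c).2 ⟨hc, e.symm⟩)
      have h1 := pos a ha ha0
      have h2 := pos b hb hb0
      rw [map_add] at hn
      exact add_mem (ih _ (by omega) a ha rfl) (ih _ (by omega) b hb rfl)
  exact fun x hx => key _ x hx rfl

lemma map_mem_hilbertBasis (A : N ≃ₗ[ℤ] N) {σ : AddSubmonoid N} {x : N}
    (hx : x ∈ hilbertBasis σ) : A x ∈ hilbertBasis (σ.map A) := by
  refine ⟨⟨x, hx.1, rfl⟩, by simpa using hx.2.1, ?_⟩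
  rintro _ ⟨a, ha, rfl⟩ _ ⟨b, hb, rfl⟩ h
  have h' : x = a + b := A.injective (by simpa using h)
  simpa using hx.2.2 a ha b hb h'

namespace Fan

variable (F : Fan N)

/-- A linear form vanishing on all the cones of the fan. -/
def IsNull (u : Module.Dual ℤ N) : Prop := ∀ σ ∈ F.cones, ∀ x ∈ σ, u x = 0

/-- The group embeds into the self-maps of the finite set `S`: if `A` and `B` agree on `S`, then
they agree on all cones, so every linear form composed with `A - B` is null and hence zero. -/
lemma finite_aut [Module.Free ℤ N] (h : ∀ u, F.IsNull u → u = 0) : Finite F.aut := by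
  let S : Set N := ⋃ σ ∈ F.cones, hilbertBasis σ
  have hS : S.Finite := F.finite.biUnion fun σ hσ => hilbertBasis_finite (F.isCone σ hσ).fg
  have := hS.to_subtype
  let Φ : F.aut → S → S := fun A x => ⟨A.1 x, by
    obtain ⟨x, hx⟩ := x
    simp only [S, Set.mem_iUnion] at hx ⊢
    obtain ⟨σ, hσ, hx⟩ := hx
    exact ⟨_, (A.2 σ).2 hσ, map_mem_hilbertBasis A.1 hx⟩⟩
  refine Finite.of_injective Φ fun A B hAB => Subtype.ext (LinearEquiv.ext fun x => ?_)
  by_contra hx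
  obtain ⟨f, hf⟩ := exists_dual_apply_ne_zero (sub_ne_zero.2 hx)
  let D : N →ₗ[ℤ] N := A.1.toLinearMap - B.1.toLinearMap
  have hD : F.IsNull (f ∘ₗ D) := by
    intro σ hσ y hy
    rw [← closure_hilbertBasis (F.stronglyConvex σ hσ)] at hy
    induction hy using AddSubmonoid.closure_induction with
    | mem y hy =>
      have hyS : y ∈ S := Set.mem_biUnion hσ hy
      have : A.1 y = B.1 y := congrArg Subtype.val (congrFun hAB ⟨y, hyS⟩)
      simp [D, this]
    | zero => simp
    | add a b _ _ ha hb => rw [map_add, ha, hb, add_zero]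
  exact hf (LinearMap.congr_fun (h _ hD) x)

/-- The transvection `x ↦ x + u(x) v` with `u(v) = 0`. -/
def transvectionEquiv (u : Module.Dual ℤ N) (v : N) (h : u v = 0) : N ≃ₗ[ℤ] N :=
  LinearEquiv.ofLinearMap (LinearMap.id + u.smulRight v) (LinearMap.id - u.smulRight v)
    (by ext x; simp [h]) (by ext x; simp [h])

lemma infinite_aut [Module.Free ℤ N] [Module.Finite ℤ N]
    (hF : ¬ (Module.finrank ℤ N = 1 ∧ F.cones = {⊥}))
    {u : Module.Dual ℤ N} (hu : F.IsNull u) (hu0 : u ≠ 0) : Infinite F.aut := by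
  obtain ⟨y, hy⟩ : ∃ y, u y ≠ 0 := by
    by_contra! h
    exact hu0 (LinearMap.ext h)
  -- If `u` had trivial kernel, `N` would embed in `ℤ` and all cones would be zero, contrary to
  -- `hF`.
  obtain ⟨v, hv, hv0⟩ : ∃ v, u v = 0 ∧ v ≠ 0 := by
    by_contra! h
    have hinj : Function.Injective u := (injective_iff_map_eq_zero u).2 h
    refine hF ⟨?_, ?_⟩
    · refine le_antisymm ?_ ?_
      · simpa using LinearMap.finrank_le_finrank_of_injective hinj
      · have : Nontrivial N := ⟨y, 0, fun e => hy (by simp [e])⟩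
        exact Module.finrank_pos
    · have key : ∀ σ ∈ F.cones, σ = ⊥ := fun σ hσ =>
        (AddSubmonoid.eq_bot_iff_forall _).2 fun x hx => h x (hu σ hσ x hx)
      obtain ⟨σ, hσ⟩ := F.nonempty
      exact Set.eq_singleton_iff_unique_mem.2 ⟨key σ hσ ▸ hσ, key⟩
  have hmem : ∀ n : ℤ, transvectionEquiv u (n • v) (by simp [hv]) ∈ F.aut := by
    intro n σ
    have fix : ∀ τ ∈ F.cones, ∀ x ∈ τ, transvectionEquiv u (n • v) (by simp [hv]) x = x := by
      intro τ hτ x hx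
      simp [transvectionEquiv, hu τ hτ x hx]
    have hmap : ∀ τ ∈ F.cones, τ.map (transvectionEquiv u (n • v) (by simp [hv])) = τ := by
      intro τ hτ
      refine SetLike.coe_injective ?_
      rw [AddSubmonoid.coe_map]
      exact (Set.image_congr (fix τ hτ)).trans (Set.image_id' _)
    -- If the image of `σ` is in the fan, the transvection maps this image to itself; cancelling the
    -- injective transvection shows that `σ` is its own image.
    refine ⟨fun h => ?_, fun h => (hmap σ h).symm ▸ h⟩
    have e := hmap _ h
    have : σ.map (transvectionEquiv u (n • v) (by simp [hv])) = σ :=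
      AddSubmonoid.map_injective_of_injective
        (f := transvectionEquiv u (n • v) (by simp [hv])) (LinearEquiv.injective _) e
    exact this ▸ h
  refine Infinite.of_injective (fun n : ℤ => (⟨_, hmem n⟩ : F.aut)) fun m n hmn => ?_
  have := LinearEquiv.congr_fun (congrArg Subtype.val hmn) y
  simp only [transvectionEquiv, LinearEquiv.coe_ofLinearMap, LinearMap.add_apply,
    LinearMap.smulRight_apply, add_right_inj, smul_smul] at this
  exact mul_left_cancel₀ hy (smul_left_injective ℤ hv0 this)

lemma bot_mem : ⊥ ∈ F.cones :=
  let ⟨σ, hσ⟩ := F.nonempty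
  F.face_mem σ hσ _ (F.stronglyConvex σ hσ)

end Fan

end Lattice

/-! ### Units of group algebras. -/

section Units

/-- Unless both supports are singletons, two different pairs of exponents have a uniquely attained
sum. Each such sum has a non-zero coefficient in `f * g = 1`, so both are `0`, which contradicts
uniqueness. -/
lemma exists_eq_single_of_mul_eq_one {k M : Type*} [Field k] [AddCommGroup M] [TwoUniqueSums M]
    {f g : AddMonoidAlgebra k M} (h : f * g = 1) :
    ∃ (w : M) (a : k), f = AddMonoidAlgebra.single w a := by
  have hf : f ≠ 0 := by rintro rfl; simp at h
  have hg : g ≠ 0 := by rintro rfl; simp at h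
  have hf' : f.coeff.support.Nonempty := by simpa using hf
  have hg' : g.coeff.support.Nonempty := by simpa using hg
  by_cases hc : 1 < f.coeff.support.card * g.coeff.support.card
  · obtain ⟨p, hp, q, hq, hpq, up, uq⟩ := TwoUniqueSums.uniqueAdd_of_one_lt_card hc
    rw [Finset.mem_product] at hp hq
    have key : ∀ r : M × M, r.1 ∈ f.coeff.support → r.2 ∈ g.coeff.support →
        UniqueAdd f.coeff.support g.coeff.support r.1 r.2 → r.1 + r.2 = 0 := by
      intro r h1 h2 hr
      by_contra hne
      have e := AddMonoidAlgebra.coeff_mul_add_of_uniqueAdd hr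
      rw [h, AddMonoidAlgebra.one_def, AddMonoidAlgebra.coeff_single,
        Finsupp.single_eq_of_ne hne] at e
      exact mul_ne_zero (Finsupp.mem_support_iff.1 h1) (Finsupp.mem_support_iff.1 h2) e.symm
    have := up hq.1 hq.2 ((key q hq.1 hq.2 uq).trans (key p hp.1 hp.2 up).symm)
    exact absurd (Prod.ext this.1 this.2).symm hpq
  · have : f.coeff.support.card = 1 := by
      have h1 := hf'.card_pos
      have h2 := hg'.card_pos
      nlinarith
    obtain ⟨w, a, -, e⟩ := Finsupp.card_support_eq_one'.1 this
    exact ⟨w, a, AddMonoidAlgebra.coeff_injective e⟩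

end Units

/-! ### Morphisms from a toric variety to a torus. -/

noncomputable section

variable {k : Type u} [Field k]

section SpecOver

variable {A B : Type u} [CommRing A] [CommRing B] [Algebra k A] [Algebra k B]

lemma specMap_injective {f g : A →ₐ[k] B} (h : specMap f = specMap g) : f = g := by
  have h1 : Spec.map (CommRingCat.ofHom f.toRingHom) = Spec.map (CommRingCat.ofHom g.toRingHom) :=
    congrArg CommaMorphism.left h
  have h2 := congrArg CommRingCat.Hom.hom (Spec.map_injective h1)
  exact AlgHom.coe_ringHom_injective h2

lemma exists_eq_specMap (f : specOver k B ⟶ specOver k A) : ∃ g : A →ₐ[k] B, f = specMap g := by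
  obtain ⟨p, hp⟩ : ∃ p, Spec.map p = f.left := ⟨_, Spec.map_preimage _⟩
  have h : f.left ≫ Spec.map (CommRingCat.ofHom (algebraMap k A)) =
    Spec.map (CommRingCat.ofHom (algebraMap k B)) := Over.w f
  rw [← hp] at h
  have h' := Spec.map_injective ((Spec.map_comp _ _).trans h)
  exact ⟨⟨p.hom, fun r => congr($h' r)⟩, Over.OverMorphism.ext hp.symm⟩

/-- The structure morphism of a scheme over `k` as a morphism to `Spec k` over `k`. -/
def toSpecBase (X : Over (base k)) : X ⟶ specOver k k :=
  Over.homMk X.hom ((congrArg _ (Spec.map_id _)).trans (Category.comp_id _))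

/-- The structure morphism of `specOver k k` is the identity, so this object is terminal over `Spec
k`. -/
lemma eq_toSpecBase {X : Over (base k)} (f : X ⟶ specOver k k) : f = toSpecBase X := by
  ext1
  have h : f.left ≫ Spec.map (CommRingCat.ofHom (algebraMap k k)) = X.hom := Over.w f
  have e : Spec.map (CommRingCat.ofHom (algebraMap k k)) = 𝟙 _ := Spec.map_id _
  exact (Category.comp_id f.left).symm.trans ((congrArg (f.left ≫ ·) e).symm.trans h)

end SpecOver

lemma single_eq_single_iff {S : Type*} {a b : S} {c d : k} :
    AddMonoidAlgebra.single a c = AddMonoidAlgebra.single b d ↔ a = b ∧ c = d ∨ c = 0 ∧ d = 0 := by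
  rw [← AddMonoidAlgebra.coeff_inj]
  exact Finsupp.single_eq_single_iff ..

lemma twoUniqueSums_dual (N : Type u) [AddCommGroup N] [Module.Free ℤ N] [Module.Finite ℤ N] :
    TwoUniqueSums (Module.Dual ℤ N) :=
  have : AddGroup.FG (Module.Dual ℤ N) := Module.Finite.iff_addGroup_fg.1 inferInstance
  have : IsAddTorsionFree (Module.Dual ℤ N) :=
    Module.isTorsionFree_int_iff_isAddTorsionFree.1 inferInstance
  inferInstance

section Charts

variable {N : Type u} [AddCommGroup N]

lemma toricVariety_hom_ext {F : Fan N} {Y : Over (base k)} {f g : toricVariety k F ⟶ Y}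
    (h : ∀ σ, chartι k F σ ≫ f = chartι k F σ ≫ g) : f = g := by
  ext1
  exact colimit.hom_ext fun σ => congrArg CommaMorphism.left (h σ)

variable (k) in
/-- The inclusion `k[σ^∨] → k[M]`. -/
def chartInclusion (σ : AddSubmonoid N) :
    AddMonoidAlgebra k (dualCone σ) →ₐ[k] AddMonoidAlgebra k (Module.Dual ℤ N) :=
  AddMonoidAlgebra.mapDomainAlgHom k k (dualCone σ).subtype

lemma chartInclusion_injective (σ : AddSubmonoid N) :
    Function.Injective (chartInclusion k σ) :=
  AddMonoidAlgebra.mapDomain_injective Subtype.val_injective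

lemma chartInclusion_restrict {τ σ : AddSubmonoid N} (h : τ ≤ σ) :
    (chartInclusion k τ).comp (restrict k h) = chartInclusion k σ :=
  algHom_ext_single k fun m => by simp [chartInclusion]

lemma mem_dualCone_of_chartInclusion_eq_single {σ : AddSubmonoid N} {w : Module.Dual ℤ N} {c : k}
    {f : AddMonoidAlgebra k (dualCone σ)} (hc : c ≠ 0)
    (h : chartInclusion k σ f = AddMonoidAlgebra.single w c) : w ∈ dualCone σ := by
  by_contra hw
  have h1 := congrArg (fun f => f.coeff w) h
  have h2 : (chartInclusion k σ f).coeff w = 0 := by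
    refine Finsupp.mapDomain_of_notMem_range _ _ ?_
    rintro ⟨x, rfl⟩
    exact hw x.2
  simp [h2] at h1
  exact hc h1.symm

variable (k) in
/-- The augmentation `k[S] → k`, `χ^s ↦ 1`. -/
def augmentation (S : Type u) [AddMonoid S] : AddMonoidAlgebra k S →ₐ[k] k :=
  AddMonoidAlgebra.lift k k S 1

@[simp] lemma augmentation_single (S : Type u) [AddMonoid S] (s : S) (c : k) :
    augmentation k S (AddMonoidAlgebra.single s c) = c := by
  simp [augmentation]

end Charts

/-- If no non-zero linear form vanishes on `Σ`, then every morphism from `X_Σ` to a split torus is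
constant. -/
lemma toricVariety_hom_torus_constant {N N₁ : Type u} [AddCommGroup N] [Module.Free ℤ N]
    [Module.Finite ℤ N] [AddCommGroup N₁] {F : Fan N} (hF : ∀ u, F.IsNull u → u = 0)
    (a : toricVariety k F ⟶ torus k N₁) :
    ∃ ε : AddMonoidAlgebra k (Module.Dual ℤ N₁) →ₐ[k] k, a = toSpecBase _ ≫ specMap ε := by
  have := twoUniqueSums_dual N
  choose g hg using fun σ : F.cones => exists_eq_specMap (chartι k F σ ≫ a)
  let o : F.cones := ⟨⊥, F.bot_mem⟩
  -- Every `U_σ` contains the chart of the zero cone, so inside `k[M]` the ring maps `g σ` all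
  -- become the same map `G`.
  let G := (chartInclusion k _).comp (g o)
  have hG : ∀ σ, (chartInclusion k _).comp (g σ) = G := by
    intro σ
    have hle : o ≤ σ := bot_le (a := σ.1)
    have e : specMap ((restrict k hle).comp (g σ)) = specMap (g o) := by
      rw [← specMap_comp, ← hg, ← hg, ← Category.assoc]
      exact congrArg (· ≫ a) (chartMap_chartι k F (homOfLE hle))
    rw [← chartInclusion_restrict hle, AlgHom.comp_assoc, specMap_injective e]
  have mul_one' : ∀ m, G (.single m 1) * G (.single (-m) 1) = 1 := by
    intro m
    rw [← map_mul, AddMonoidAlgebra.single_mul_single, add_neg_cancel, one_mul,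
      ← AddMonoidAlgebra.one_def, map_one]
  have key : ∀ m, G (.single m 1) = algebraMap k _ (augmentation k _ (G (.single m 1))) := by
    intro m
    obtain ⟨w, c, hw⟩ := exists_eq_single_of_mul_eq_one (mul_one' m)
    obtain ⟨w', c', hw'⟩ := exists_eq_single_of_mul_eq_one
      ((mul_comm _ _).trans (mul_one' m))
    have h := mul_one' m
    rw [hw, hw', AddMonoidAlgebra.single_mul_single, AddMonoidAlgebra.one_def] at h
    have hcc : w + w' = 0 ∧ c * c' = 1 := by
      rcases single_eq_single_iff.1 h with h | h
      · exact h
      · exact absurd h.2 one_ne_zero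
    -- `G` factors through every `k[σ^∨]`, so the exponents `w` of `G (χ^m)` and `-w` of its inverse
    -- lie in every `σ^∨`: the form `w` is null.
    have hw0 : w = 0 := by
      refine hF w fun σ hσ x hx => le_antisymm ?_ ?_
      · have := mem_dualCone_of_chartInclusion_eq_single (right_ne_zero_of_mul_eq_one hcc.2)
          ((AlgHom.congr_fun (hG ⟨σ, hσ⟩) _).trans hw') x hx
        rw [eq_neg_of_add_eq_zero_right hcc.1] at this
        simpa using this
      · exact mem_dualCone_of_chartInclusion_eq_single (left_ne_zero_of_mul_eq_one hcc.2)
          ((AlgHom.congr_fun (hG ⟨σ, hσ⟩) _).trans hw) x hx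
    rw [hw, hw0, augmentation_single]
    rfl
  refine ⟨(augmentation k _).comp G, toricVariety_hom_ext fun σ => ?_⟩
  rw [← Category.assoc, eq_toSpecBase (chartι k F σ ≫ toSpecBase _),
    ← eq_toSpecBase (specMap (Algebra.ofId k _)), specMap_comp, hg]
  refine congrArg specMap (algHom_ext_single k fun m => chartInclusion_injective _ ?_)
  refine (AlgHom.congr_fun (hG σ) _).trans ((key m).trans ?_)
  exact ((chartInclusion k σ.1).commutes _).symm

/-- Even a non-equivariant isomorphism is impossible: the projection to `𝕋_{N₁}` would be constant
although it has a section. -/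
lemma not_hasTorusFactor {N : Type u} [AddCommGroup N] [Module.Free ℤ N]
    [Module.Finite ℤ N] {F : Fan N} (hF : ∀ u, F.IsNull u → u = 0) : ¬ HasTorusFactor k F := by
  rintro ⟨N₁, N₂, _, _, _, _, _, _, F₂, φ, α, hN, -, -⟩
  obtain ⟨ε, hε⟩ := toricVariety_hom_torus_constant hF (α.hom ≫ fst _ _)
  -- The constant morphism to the `k`-point of the zero cone's chart where all characters equal `1`;
  -- it serves to build the section.
  let r : torus k N₁ ⟶ toricVariety k F₂ :=
    toSpecBase _ ≫ specMap (augmentation k _) ≫ chartι k F₂ ⟨⊥, F₂.bot_mem⟩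
  have h1 : (lift (𝟙 _) r ≫ α.inv) ≫ α.hom ≫ fst _ _ = 𝟙 _ := by simp
  rw [hε, ← Category.assoc, eq_toSpecBase (_ ≫ toSpecBase _),
    ← eq_toSpecBase (specMap (Algebra.ofId k _)), specMap_comp, ← specMap_id] at h1
  obtain ⟨x, hx⟩ := exists_ne (0 : N₁)
  obtain ⟨m, hm⟩ := exists_dual_apply_ne_zero hx
  have h2 := AlgHom.congr_fun (specMap_injective h1) (.single m 1)
  -- The identity of `𝕋_{N₁}` being constant, the character `χ^m` would be a scalar even though `m ≠
  -- 0`.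
  have h3 : AddMonoidAlgebra.single 0 (ε (.single m 1)) = AddMonoidAlgebra.single m (1 : k) := h2
  rcases single_eq_single_iff.1 h3 with h | h
  · exact hm (by simp [← h.1])
  · exact one_ne_zero h.2

end

/-! ### Points with values in algebras, and equivariant toric morphisms. -/

noncomputable section

section Algebra

variable (k : Type u) [Field k] {N N' : Type u} [AddCommGroup N] [AddCommGroup N']

/-- The homomorphism of group algebras `k[M'] → k[M]` given by a homomorphism `N → N'`. -/
def torusAlgHom (f : N →ₗ[ℤ] N') :
    AddMonoidAlgebra k (Module.Dual ℤ N') →ₐ[k] AddMonoidAlgebra k (Module.Dual ℤ N) :=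
  AddMonoidAlgebra.mapDomainAlgHom k k f.dualMap.toAddMonoidHom

@[simp] lemma torusAlgHom_single (f : N →ₗ[ℤ] N') (u : Module.Dual ℤ N') (c : k) :
    torusAlgHom k f (.single u c) = .single (u ∘ₗ f) c := by
  simp [torusAlgHom]
  rfl

/-- The pullback of linear forms `σ'^∨ → σ^∨` along a homomorphism mapping `σ` to `σ'`. -/
def dualConeMap (f : N →ₗ[ℤ] N') {σ : AddSubmonoid N} {σ' : AddSubmonoid N'}
    (h : ∀ x ∈ σ, f x ∈ σ') : dualCone σ' →+ dualCone σ where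
  toFun u := ⟨u.1 ∘ₗ f, fun x hx => u.2 _ (h x hx)⟩
  map_zero' := rfl
  map_add' _ _ := rfl

/-- The homomorphism `k[σ'^∨] → k[σ^∨]` given by a homomorphism `N → N'` mapping `σ` to `σ'`. -/
def chartAlgHom (f : N →ₗ[ℤ] N') {σ : AddSubmonoid N} {σ' : AddSubmonoid N'}
    (h : ∀ x ∈ σ, f x ∈ σ') :
    AddMonoidAlgebra k (dualCone σ') →ₐ[k] AddMonoidAlgebra k (dualCone σ) :=
  AddMonoidAlgebra.mapDomainAlgHom k k (dualConeMap f h)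

@[simp] lemma chartAlgHom_single (f : N →ₗ[ℤ] N') {σ : AddSubmonoid N} {σ' : AddSubmonoid N'}
    (h : ∀ x ∈ σ, f x ∈ σ') (u : dualCone σ') (c : k) :
    chartAlgHom k f h (.single u c) =
      .single ⟨u.1 ∘ₗ f, fun x hx => u.2 _ (h x hx)⟩ c := by
  simp [chartAlgHom, dualConeMap]

/-- The homomorphism `k[M'] → k[σ^∨]` given by a homomorphism `N → N'` vanishing on `σ`. -/
def nullAlgHom (f : N →ₗ[ℤ] N') {σ : AddSubmonoid N} (h : ∀ x ∈ σ, f x = 0) :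
    AddMonoidAlgebra k (Module.Dual ℤ N') →ₐ[k] AddMonoidAlgebra k (dualCone σ) :=
  AddMonoidAlgebra.mapDomainAlgHom k k
    (f.dualMap.toAddMonoidHom.codRestrict (dualCone σ) fun u x hx => by simp [h x hx])

@[simp] lemma nullAlgHom_single (f : N →ₗ[ℤ] N') {σ : AddSubmonoid N} (h : ∀ x ∈ σ, f x = 0)
    (u : Module.Dual ℤ N') (c : k) :
    nullAlgHom k f h (.single u c) =
      .single ⟨u ∘ₗ f, fun x hx => by simp [h x hx]⟩ c := by
  simp [nullAlgHom, AddMonoidHom.codRestrict]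
  rfl

end Algebra

section Points

variable {k : Type u} [Field k]

section Affine

variable {A B : Type u} [CommRing A] [CommRing B] [Algebra k A] [Algebra k B]

lemma lift_specMap_specProdIso {C : Type u} [CommRing C] [Algebra k C] (f : A →ₐ[k] C) (g : B →ₐ[k] C) :
    lift (specMap f) (specMap g) ≫ (specProdIso A B).hom =
      specMap (Algebra.TensorProduct.productMap f g) := by
  rw [← Iso.eq_comp_inv]
  ext1
  · rw [lift_fst, Category.assoc, specProdIso_inv_fst, specMap_comp,
      Algebra.TensorProduct.productMap_left]
  · rw [lift_snd, Category.assoc, specProdIso_inv_snd, specMap_comp,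
      Algebra.TensorProduct.productMap_right]

variable (A B) in
lemma specProdIso_inv_eq_lift : (specProdIso (k := k) A B).inv =
    lift (specMap Algebra.TensorProduct.includeLeft)
      (specMap Algebra.TensorProduct.includeRight) := by
  ext1
  · rw [lift_fst, specProdIso_inv_fst]
  · rw [lift_snd, specProdIso_inv_snd]

/-- Morphisms out of a product of affine schemes are determined by their values on points with
values in affine schemes. -/
lemma specOver_tensor_hom_ext {Y : Over (base k)} {f g : specOver k A ⊗ specOver k B ⟶ Y}
    (h : ∀ (C : Type u) [CommRing C] [Algebra k C] (x : A →ₐ[k] C) (y : B →ₐ[k] C),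
      lift (specMap x) (specMap y) ≫ f = lift (specMap x) (specMap y) ≫ g) : f = g := by
  rw [← cancel_epi (specProdIso A B).inv, specProdIso_inv_eq_lift]
  exact h _ _ _

end Affine

variable {N : Type u} [AddCommGroup N]

lemma lift_specMap_chartAct {C : Type u} [CommRing C] [Algebra k C] {σ : AddSubmonoid N}
    (x : AddMonoidAlgebra k (Module.Dual ℤ N) →ₐ[k] C)
    (y : AddMonoidAlgebra k (dualCone σ) →ₐ[k] C) :
    lift (specMap x) (specMap y) ≫ chartAct k σ =
      specMap ((Algebra.TensorProduct.productMap x y).comp (coaction k σ)) := by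
  rw [chartAct, ← Category.assoc, lift_specMap_specProdIso, specMap_comp]

lemma torus_mul_eq : (MonObj.mul : torus k N ⊗ torus k N ⟶ torus k N) =
    (specProdIso _ _).hom ≫ specMap (Bialgebra.comulAlgHom k _) := by
  ext1
  rfl

lemma lift_specMap_mul {C : Type u} [CommRing C] [Algebra k C]
    (x y : AddMonoidAlgebra k (Module.Dual ℤ N) →ₐ[k] C) :
    lift (specMap x) (specMap y) ≫ (MonObj.mul : torus k N ⊗ torus k N ⟶ torus k N) =
      specMap ((Algebra.TensorProduct.productMap x y).comp (Bialgebra.comulAlgHom k _)) := by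
  rw [torus_mul_eq, ← Category.assoc, lift_specMap_specProdIso, specMap_comp]

/-- Abstract form of the fact that the preimage of a chart `U` in `T × X` maps to `T × U`. -/
lemma eq_lift_whiskerLeft {𝒞 : Type*} [Category* 𝒞] [CartesianMonoidalCategory 𝒞] {T U X Z : 𝒞}
    (π : Z ⟶ T ⊗ X) (ρ : Z ⟶ U) (j : U ⟶ X) (h : ρ ≫ j = π ≫ snd T X) :
    π = lift (π ≫ fst T X) ρ ≫ T ◁ j := by
  ext1
  · simp
  · simp [h]

/-- The preimages of the `U_σ` cover the product, and the inclusion of each one factors through `T ×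
U_σ`. -/
lemma tensor_toricVariety_hom_ext {F : Fan N} {T Y : Over (base k)}
    {f g : T ⊗ toricVariety k F ⟶ Y} (h : ∀ σ, T ◁ chartι k F σ ≫ f = T ◁ chartι k F σ ≫ g) :
    f = g := by
  ext1
  refine Scheme.Cover.hom_ext ((chartCover k F).pullback₁ (snd T (toricVariety k F)).left) _ _ fun σ => ?_
  let π : Over.mk (pullback.fst (snd T (toricVariety k F)).left (chartι k F σ).left ≫
      (T ⊗ toricVariety k F).hom) ⟶ T ⊗ toricVariety k F := Over.homMk (pullback.fst _ _)
  let ρ : Over.mk (pullback.fst (snd T (toricVariety k F)).left (chartι k F σ).left ≫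
      (T ⊗ toricVariety k F).hom) ⟶ chart k σ.1 := Over.homMk (pullback.snd _ _) (by
    rw [← Over.w (chartι k F σ), ← pullback.condition_assoc, Over.w]; rfl)
  have hρ : ρ ≫ chartι k F σ = π ≫ snd _ _ := by
    ext1
    exact pullback.condition.symm
  have : π ≫ f = π ≫ g := by
    rw [eq_lift_whiskerLeft π ρ _ hρ, Category.assoc, Category.assoc, h σ]
  exact congrArg CommaMorphism.left this

/-- Morphisms out of the product of an affine scheme and a toric variety are determined by their
values on points with values in affine schemes. -/
lemma specOver_tensor_toricVariety_hom_ext {A : Type u} [CommRing A] [Algebra k A] {F : Fan N}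
    {Y : Over (base k)} {f g : specOver k A ⊗ toricVariety k F ⟶ Y}
    (h : ∀ (σ : F.cones) (C : Type u) [CommRing C] [Algebra k C] (x : A →ₐ[k] C)
      (y : AddMonoidAlgebra k (dualCone σ.1) →ₐ[k] C),
      lift (specMap x) (specMap y ≫ chartι k F σ) ≫ f =
        lift (specMap x) (specMap y ≫ chartι k F σ) ≫ g) : f = g := by
  refine tensor_toricVariety_hom_ext fun σ => specOver_tensor_hom_ext fun C _ _ x y => ?_
  simpa only [lift_whiskerLeft_assoc] using h σ C x y

lemma lift_specMap_torusAct {C : Type u} [CommRing C] [Algebra k C] {F : Fan N} {σ : F.cones}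
    (x : AddMonoidAlgebra k (Module.Dual ℤ N) →ₐ[k] C)
    (y : AddMonoidAlgebra k (dualCone σ.1) →ₐ[k] C) :
    lift (specMap x) (specMap y ≫ chartι k F σ) ≫ torusAct k F =
      specMap ((Algebra.TensorProduct.productMap x y).comp (coaction k σ.1)) ≫ chartι k F σ := by
  rw [← lift_whiskerLeft, Category.assoc, whiskerLeft_chartι_torusAct, ← Category.assoc,
    lift_specMap_chartAct]

end Points

section Morphisms

variable (k : Type u) [Field k] {N N' : Type u} [AddCommGroup N] [AddCommGroup N']

variable {k} in
/-- The morphism out of `X_Σ` glued from compatible morphisms out of the `U_σ`. -/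
def toricDesc {F : Fan N} {Y : Over (base k)} (f : ∀ σ : F.cones, chart k σ.1 ⟶ Y)
    (hf : ∀ (τ σ : F.cones) (h : τ ≤ σ), chartMap k h ≫ f σ = f τ) : toricVariety k F ⟶ Y :=
  Over.homMk (colimit.desc (schemeDiagram k F)
    ⟨Y.left, { app := fun σ => (f σ).left, naturality := fun τ σ h =>
      (congrArg CommaMorphism.left (hf τ σ (leOfHom h))).trans (Category.comp_id _).symm }⟩)
    (colimit.hom_ext fun σ => (colimit.ι_desc_assoc _ _ _).trans
      ((Over.w (f σ)).trans (Over.w (chartι k F σ)).symm))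

variable {k} in
@[simp] lemma chartι_toricDesc {F : Fan N} {Y : Over (base k)} (f : ∀ σ : F.cones, chart k σ.1 ⟶ Y)
    (hf : ∀ (τ σ : F.cones) (h : τ ≤ σ), chartMap k h ≫ f σ = f τ) (σ : F.cones) :
    chartι k F σ ≫ toricDesc f hf = f σ := by
  ext1
  exact colimit.ι_desc _ _

/-- The toric morphism `X_Σ → X_Σ'` given by a homomorphism `N → N'` and an order preserving map
`Φ` on the sets of cones such that `σ` is mapped to `Φ σ`. -/
def toricMap {F : Fan N} {F' : Fan N'} (f : N →ₗ[ℤ] N') (Φ : F.cones →o F'.cones)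
    (h : ∀ σ : F.cones, ∀ x ∈ σ.1, f x ∈ (Φ σ).1) : toricVariety k F ⟶ toricVariety k F' :=
  toricDesc (fun σ => specMap (chartAlgHom k f (h σ)) ≫ chartι k F' (Φ σ)) fun τ σ hle => by
    rw [← chartMap_chartι k F' (homOfLE (Φ.monotone hle)), chartMap, chartMap, ← Category.assoc,
      ← Category.assoc, specMap_comp, specMap_comp]
    congr 2
    refine algHom_ext_single k fun m => ?_
    rw [AlgHom.comp_apply, AlgHom.comp_apply, chartAlgHom_single, restrict_single,
      restrict_single, chartAlgHom_single]
    rfl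

@[simp] lemma chartι_toricMap {F : Fan N} {F' : Fan N'} (f : N →ₗ[ℤ] N') (Φ : F.cones →o F'.cones)
    (h : ∀ σ : F.cones, ∀ x ∈ σ.1, f x ∈ (Φ σ).1) (σ : F.cones) :
    chartι k F σ ≫ toricMap k f Φ h = specMap (chartAlgHom k f (h σ)) ≫ chartι k F' (Φ σ) :=
  chartι_toricDesc ..

/-- Equivariance can be tested on points `(x, y)` of a chart, where both sides send `χ^m` to `x(χ^{m
∘ f}) y(χ^{m ∘ f})`. -/
lemma torusAct_toricMap {F : Fan N} {F' : Fan N'} (f : N →ₗ[ℤ] N') (Φ : F.cones →o F'.cones)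
    (h : ∀ σ : F.cones, ∀ x ∈ σ.1, f x ∈ (Φ σ).1) :
    torusAct k F ≫ toricMap k f Φ h =
      (specMap (torusAlgHom k f) ⊗ₘ toricMap k f Φ h) ≫ torusAct k F' := by
  refine specOver_tensor_toricVariety_hom_ext fun σ C _ _ x y => ?_
  rw [← Category.assoc, lift_specMap_torusAct, Category.assoc, chartι_toricMap, lift_map_assoc,
    Category.assoc, chartι_toricMap, ← Category.assoc, ← Category.assoc, specMap_comp,
    specMap_comp, specMap_comp, lift_specMap_torusAct]
  congr 2
  refine algHom_ext_single k fun m => ?_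
  simp

/-- The morphism `X_Σ → 𝕋_N'` given by a homomorphism `N → N'` vanishing on `Σ`. -/
def toTorus (F : Fan N) (f : N →ₗ[ℤ] N') (h : ∀ σ ∈ F.cones, ∀ x ∈ σ, f x = 0) :
    toricVariety k F ⟶ torus k N' :=
  toricDesc (fun σ => specMap (nullAlgHom k f (h σ.1 σ.2))) fun τ σ hle => by
    rw [chartMap, specMap_comp]
    congr 1
    refine algHom_ext_single k fun m => ?_
    rw [AlgHom.comp_apply, nullAlgHom_single, restrict_single, nullAlgHom_single]
    rfl

@[simp] lemma chartι_toTorus (F : Fan N) (f : N →ₗ[ℤ] N') (h : ∀ σ ∈ F.cones, ∀ x ∈ σ, f x = 0)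
    (σ : F.cones) :
    chartι k F σ ≫ toTorus k F f h = specMap (nullAlgHom k f (h σ.1 σ.2)) :=
  chartι_toricDesc ..

lemma torusAct_toTorus (F : Fan N) (f : N →ₗ[ℤ] N') (h : ∀ σ ∈ F.cones, ∀ x ∈ σ, f x = 0) :
    torusAct k F ≫ toTorus k F f h =
      (specMap (torusAlgHom k f) ⊗ₘ toTorus k F f h) ≫ MonObj.mul := by
  refine specOver_tensor_toricVariety_hom_ext fun σ C _ _ x y => ?_
  rw [← Category.assoc, lift_specMap_torusAct, Category.assoc, chartι_toTorus, lift_map_assoc,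
    Category.assoc, chartι_toTorus, specMap_comp, specMap_comp, specMap_comp, lift_specMap_mul]
  congr 1
  refine algHom_ext_single k fun m => ?_
  simp

instance (f : N →ₗ[ℤ] N') : IsMonHom (specMap (torusAlgHom k f)) where
  one_hom := by
    ext1
    refine (Spec.map_comp _ _).symm.trans (congrArg Spec.map ?_)
    refine CommRingCat.hom_ext (congrArg AlgHom.toRingHom (?_ :
      (Bialgebra.counitAlgHom k _).comp (torusAlgHom k f) = Bialgebra.counitAlgHom k _))
    refine algHom_ext_single k fun m => ?_
    simp
  mul_hom := by
    refine specOver_tensor_hom_ext fun C _ _ x y => ?_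
    rw [← Category.assoc, lift_specMap_mul, lift_map_assoc, specMap_comp, specMap_comp,
      specMap_comp, lift_specMap_mul]
    congr 1
    refine algHom_ext_single k fun m => ?_
    simp

end Morphisms

end

/-! ### Splitting off a torus factor. -/

noncomputable section

/-- A decomposition of `N` as a direct sum of `N₁` and `N₂`, with projections `q`, `p` and
inclusions `s`, `i`. -/
structure Splitting (N N₁ N₂ : Type u) [AddCommGroup N] [AddCommGroup N₁] [AddCommGroup N₂] where
  q : N →ₗ[ℤ] N₁
  s : N₁ →ₗ[ℤ] N
  p : N →ₗ[ℤ] N₂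
  i : N₂ →ₗ[ℤ] N
  q_s : ∀ x, q (s x) = x
  p_i : ∀ x, p (i x) = x
  q_i : ∀ x, q (i x) = 0
  p_s : ∀ x, p (s x) = 0
  add_eq : ∀ x, s (q x) + i (p x) = x

namespace Splitting

variable {N N₁ N₂ : Type u} [AddCommGroup N] [AddCommGroup N₁] [AddCommGroup N₂]
  (S : Splitting N N₁ N₂)

lemma i_injective : Function.Injective S.i := Function.LeftInverse.injective S.p_i

lemma i_p_of_q_eq_zero {x : N} (hx : S.q x = 0) : S.i (S.p x) = x := by
  simpa [hx] using S.add_eq x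

lemma map_i_map_p {σ : AddSubmonoid N} (h : ∀ x ∈ σ, S.q x = 0) : (σ.map S.p).map S.i = σ := by
  refine SetLike.coe_injective ?_
  rw [AddSubmonoid.coe_map, AddSubmonoid.coe_map, Set.image_image]
  exact (Set.image_congr fun x hx => S.i_p_of_q_eq_zero (h x hx)).trans (Set.image_id' _)

lemma map_p_map_i (τ : AddSubmonoid N₂) : (τ.map S.i).map S.p = τ := by
  refine SetLike.coe_injective ?_
  rw [AddSubmonoid.coe_map, AddSubmonoid.coe_map, Set.image_image]
  exact (Set.image_congr fun x _ => S.p_i x).trans (Set.image_id' _)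

lemma i_mem_map_i {τ : AddSubmonoid N₂} {x : N₂} : S.i x ∈ τ.map S.i ↔ x ∈ τ :=
  AddSubmonoid.mem_map_iff_mem (f := S.i.toAddMonoidHom) S.i_injective

/-- Forms defining faces restrict along `i` and extend along `p`. -/
lemma isFace_map_i {τ σ : AddSubmonoid N₂} : IsFace (τ.map S.i) (σ.map S.i) ↔ IsFace τ σ := by
  constructor
  · rintro ⟨u, hu, h⟩
    refine ⟨u ∘ₗ S.i, fun x hx => hu _ (S.i_mem_map_i.2 hx), fun x => ?_⟩
    rw [← S.i_mem_map_i, h, S.i_mem_map_i, LinearMap.comp_apply]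
  · rintro ⟨u, hu, h⟩
    refine ⟨u ∘ₗ S.p, ?_, fun x => ⟨?_, ?_⟩⟩
    · rintro _ ⟨x, hx, rfl⟩
      rw [LinearMap.comp_apply]
      exact (S.p_i x).symm ▸ hu x hx
    · rintro ⟨y, hy, rfl⟩
      refine ⟨S.i_mem_map_i.2 ((h y).1 hy).1, ?_⟩
      rw [LinearMap.comp_apply]
      exact (S.p_i y).symm ▸ ((h y).1 hy).2
    · rintro ⟨⟨y, hy, rfl⟩, h0⟩
      rw [LinearMap.comp_apply] at h0
      exact S.i_mem_map_i.2 ((h y).2 ⟨hy, (S.p_i y) ▸ h0⟩)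

variable {F : Fan N} (hF : ∀ σ ∈ F.cones, ∀ x ∈ σ, S.q x = 0)

include hF in
lemma map_p_mem {σ : AddSubmonoid N} (hσ : σ ∈ F.cones) : (σ.map S.p).map S.i ∈ F.cones :=
  (S.map_i_map_p (hF σ hσ)).symm ▸ hσ

/-- A fan in `N₁ ⊕ N₂` whose cones are contained in `N₂`, as a fan in `N₂`. -/
def fan : Fan N₂ where
  cones := {τ | τ.map S.i ∈ F.cones}
  finite := F.finite.preimage
    (AddSubmonoid.map_injective_of_injective (f := S.i) S.i_injective).injOn
  nonempty :=
    let ⟨σ, hσ⟩ := F.nonempty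
    ⟨σ.map S.p, S.map_p_mem hF hσ⟩
  isCone τ hτ :=
    { fg := S.map_p_map_i τ ▸ (F.isCone _ hτ).fg.map S.p.toAddMonoidHom
      saturated := fun n x hn hx => S.i_mem_map_i.1 ((F.isCone _ hτ).saturated n _ hn
        (map_nsmul S.i n x ▸ S.i_mem_map_i.2 hx)) }
  stronglyConvex τ hτ := S.isFace_map_i.1 <| by
    rw [AddSubmonoid.map_bot]
    exact F.stronglyConvex _ hτ
  face_mem σ hσ τ h := F.face_mem _ hσ _ (S.isFace_map_i.2 h)
  inter_isFace σ hσ τ hτ := by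
    have h := F.inter_isFace _ hσ _ hτ
    rwa [← AddSubmonoid.map_inf _ _ _ S.i_injective, S.isFace_map_i, S.isFace_map_i] at h

/-- The map on cones given by the projection to `N₂`. -/
def projCones : F.cones →o (S.fan hF).cones where
  toFun σ := ⟨σ.1.map S.p, S.map_p_mem hF σ.2⟩
  monotone' _ _ h := AddSubmonoid.monotone_map (f := S.p) h

/-- The map on cones given by the inclusion of `N₂`. -/
def inclCones : (S.fan hF).cones →o F.cones where
  toFun τ := ⟨τ.1.map S.i, τ.2⟩
  monotone' _ _ h := AddSubmonoid.monotone_map (f := S.i) h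

lemma p_mem_projCones (σ : F.cones) (x : N) (hx : x ∈ σ.1) : S.p x ∈ (S.projCones hF σ).1 :=
  ⟨x, hx, rfl⟩

lemma i_mem_inclCones (τ : (S.fan hF).cones) (x : N₂) (hx : x ∈ τ.1) :
    S.i x ∈ (S.inclCones hF τ).1 :=
  ⟨x, hx, rfl⟩

/-- The two cones are equal, but an inequality is what gives a chart morphism, so no transport along
an equality of cones is needed. -/
lemma le_inclCones_projCones (σ : F.cones) : σ ≤ S.inclCones hF (S.projCones hF σ) :=
  (S.map_i_map_p (hF σ.1 σ.2)).ge

lemma le_projCones_inclCones (τ : (S.fan hF).cones) : τ ≤ S.projCones hF (S.inclCones hF τ) :=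
  (S.map_p_map_i τ.1).ge

variable (k : Type u) [Field k]

/-- The projection `X_Σ → X_Σ₂`. -/
def proj : toricVariety k F ⟶ toricVariety k (S.fan hF) :=
  toricMap k S.p (S.projCones hF) (S.p_mem_projCones hF)

/-- The inclusion `X_Σ₂ → X_Σ`. -/
def incl : toricVariety k (S.fan hF) ⟶ toricVariety k F :=
  toricMap k S.i (S.inclCones hF) (S.i_mem_inclCones hF)

/-- The isomorphism `𝕋_N ≅ 𝕋_N₁ × 𝕋_N₂`. -/
def torusIso : torus k N ≅ torus k N₁ ⊗ torus k N₂ where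
  hom := lift (specMap (torusAlgHom k S.q)) (specMap (torusAlgHom k S.p))
  inv := (specMap (torusAlgHom k S.s) ⊗ₘ specMap (torusAlgHom k S.i)) ≫ MonObj.mul
  hom_inv_id := by
    rw [lift_map_assoc, specMap_comp, specMap_comp, lift_specMap_mul, ← specMap_id]
    refine congrArg specMap (algHom_ext_single k fun m => ?_)
    -- The product of the two pulled back characters has exponent `m ∘ (s ∘ q + i ∘ p) = m`.
    simp [AddMonoidAlgebra.single_mul_single]
    congr 1
    ext x
    simp [← map_add, S.add_eq]
  inv_hom_id := by
    refine specOver_tensor_hom_ext fun C _ _ x y => ?_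
    rw [Category.assoc, lift_map_assoc, specMap_comp, specMap_comp, ← Category.assoc,
      lift_specMap_mul, comp_lift, specMap_comp, specMap_comp, Category.comp_id]
    congr 2
    · refine algHom_ext_single k fun m => ?_
      have h1 : (m ∘ₗ S.q) ∘ₗ S.s = m := by ext x; simp [S.q_s]
      have h2 : (m ∘ₗ S.q) ∘ₗ S.i = 0 := by ext x; simp [S.q_i]
      simp [h1, h2, ← AddMonoidAlgebra.one_def]
    · refine algHom_ext_single k fun m => ?_
      have h1 : (m ∘ₗ S.p) ∘ₗ S.s = 0 := by ext x; simp [S.p_s]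
      have h2 : (m ∘ₗ S.p) ∘ₗ S.i = m := by ext x; simp [S.p_i]
      simp [h1, h2, ← AddMonoidAlgebra.one_def]

instance : IsMonHom (S.torusIso k).hom :=
  inferInstanceAs (IsMonHom (lift (specMap (torusAlgHom k S.q)) (specMap (torusAlgHom k S.p))))

/-- The isomorphism `X_Σ ≅ 𝕋_N₁ × X_Σ₂`. -/
def toricVarietyIso : toricVariety k F ≅ torus k N₁ ⊗ toricVariety k (S.fan hF) where
  hom := lift (toTorus k F S.q hF) (S.proj hF k)
  -- On points this is `(t, x) ↦ s(t) · i(x)`, with the action of `𝕋_N` on `X_Σ`.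
  inv := (specMap (torusAlgHom k S.s) ⊗ₘ S.incl hF k) ≫ torusAct k F
  hom_inv_id := by
    refine toricVariety_hom_ext fun σ => ?_
    rw [lift_map_assoc, ← Category.assoc, comp_lift, proj, incl, ← Category.assoc,
      chartι_toTorus, specMap_comp, ← Category.assoc, chartι_toricMap, Category.assoc,
      chartι_toricMap, ← Category.assoc, specMap_comp, lift_specMap_torusAct, Category.comp_id,
      -- The round trip ends in the chart of `inclCones (projCones σ)`, so the original chart is
      -- also factored through that one; what remains is an identity of ring maps.
      ← chartMap_chartι k F (homOfLE (S.le_inclCones_projCones hF σ)), chartMap]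
    congr 2
    refine algHom_ext_single k fun m => ?_
    simp [AddMonoidAlgebra.single_mul_single]
    congr 1
    ext x
    simp [← map_add, S.add_eq]
  inv_hom_id := by
    refine specOver_tensor_toricVariety_hom_ext fun τ C _ _ x y => ?_
    rw [Category.assoc, lift_map_assoc, specMap_comp, incl, Category.assoc, chartι_toricMap,
      ← Category.assoc (specMap y), specMap_comp, ← Category.assoc, lift_specMap_torusAct,
      comp_lift, Category.assoc, chartι_toTorus, specMap_comp, proj, Category.assoc,
      chartι_toricMap, ← Category.assoc, specMap_comp, Category.comp_id,
      ← chartMap_chartι k _ (homOfLE (S.le_projCones_inclCones hF τ)), chartMap,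
      ← Category.assoc, specMap_comp]
    congr 3
    · refine algHom_ext_single k fun m => ?_
      have h1 : (m ∘ₗ S.q) ∘ₗ S.s = m := by ext x; simp [S.q_s]
      have h2 : (m ∘ₗ S.q) ∘ₗ S.i = 0 := by ext x; simp [S.q_i]
      rw [AlgHom.comp_apply, AlgHom.comp_apply, nullAlgHom_single, coaction_single,
        Algebra.TensorProduct.productMap_apply_tmul, AlgHom.comp_apply, AlgHom.comp_apply,
        torusAlgHom_single, chartAlgHom_single]
      simp only [h1, h2]
      -- The second factor is `y` of the trivial character, because `q ∘ i = 0`.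
      exact (congrArg (_ * ·) (map_one y)).trans (mul_one _)
    · refine algHom_ext_single k fun m => ?_
      have h1 : (m.1 ∘ₗ S.p) ∘ₗ S.s = 0 := by ext x; simp [S.p_s]
      have h2 : (m.1 ∘ₗ S.p) ∘ₗ S.i = m := by ext x; simp [S.p_i]
      simp [h1, h2, ← AddMonoidAlgebra.one_def]
      rfl

/-- Both components of the isomorphism are equivariant, by `torusAct_toTorus` and
`torusAct_toricMap`; `tensorμ` only reorders the factors. -/
lemma torusAct_toricVarietyIso :
    torusAct k F ≫ (S.toricVarietyIso hF k).hom =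
      ((S.torusIso k).hom ⊗ₘ (S.toricVarietyIso hF k).hom) ≫ prodAct k N₁ (S.fan hF) := by
  have key : (torusAct k F ≫ lift (toTorus k F S.q hF) (S.proj hF k)) =
      lift ((specMap (torusAlgHom k S.q) ⊗ₘ toTorus k F S.q hF) ≫ MonObj.mul)
        ((specMap (torusAlgHom k S.p) ⊗ₘ S.proj hF k) ≫ torusAct k _) := by
    rw [comp_lift, torusAct_toTorus, proj, torusAct_toricMap]
  refine key.trans ?_
  rw [prodAct]
  ext1
  · rw [lift_fst, Category.assoc, Category.assoc, tensorHom_fst, ← Category.assoc (tensorμ _ _ _ _),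
      tensorμ_fst, ← Category.assoc, tensorHom_comp_tensorHom]
    simp [torusIso, toricVarietyIso]
  · rw [lift_snd, Category.assoc, Category.assoc, tensorHom_snd, ← Category.assoc (tensorμ _ _ _ _),
      tensorμ_snd, ← Category.assoc, tensorHom_comp_tensorHom]
    simp [torusIso, toricVarietyIso]

end Splitting

/-- The decomposition `N ≅ N / ker u ⊕ ker u` given by a linear form `u`. -/
lemma exists_splitting {N : Type u} [AddCommGroup N] [Module.Free ℤ N] [Module.Finite ℤ N]
    (u : Module.Dual ℤ N) (hu : u ≠ 0) :
    ∃ (N₁ N₂ : Type u) (_ : AddCommGroup N₁) (_ : AddCommGroup N₂)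
      (_ : Module.Free ℤ N₁) (_ : Module.Finite ℤ N₁)
      (_ : Module.Free ℤ N₂) (_ : Module.Finite ℤ N₂) (S : Splitting N N₁ N₂),
      Nontrivial N₁ ∧ ∀ x, u x = 0 → S.q x = 0 := by
  let K : Submodule ℤ N := LinearMap.ker u
  -- The quotient is isomorphic to a subgroup of `ℤ`, hence free, and so the quotient map has a
  -- section `s`.
  have hfree : Module.Free ℤ (N ⧸ K) := .of_equiv u.quotKerEquivRange.symm
  obtain ⟨s, hs⟩ := Module.projective_lifting_property K.mkQ LinearMap.id K.mkQ_surjective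
  have hs' : ∀ x, K.mkQ (s x) = x := LinearMap.congr_fun hs
  have hp : ∀ x, x - s (K.mkQ x) ∈ K := fun x => by
    rw [← Submodule.Quotient.mk_eq_zero, ← Submodule.mkQ_apply, map_sub, hs', sub_self]
  have hK : ∀ x ∈ K, K.mkQ x = 0 := fun x hx => by
    rwa [← LinearMap.mem_ker, Submodule.ker_mkQ]
  refine ⟨N ⧸ K, K, inferInstance, inferInstance, hfree, inferInstance, inferInstance,
    inferInstance, ⟨K.mkQ, s, (LinearMap.id - s ∘ₗ K.mkQ).codRestrict K hp, K.subtype, hs', ?_, ?_,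
      ?_, ?_⟩, ?_, ?_⟩
  · intro x
    ext
    simp [hK x x.2]
  · exact fun x => hK x x.2
  · intro x
    ext
    simp [hs']
  · intro x
    simp
  · exact Submodule.Quotient.nontrivial_iff.2 fun h => hu (LinearMap.ker_eq_top.1 h)
  · exact fun x hx => hK x hx

lemma hasTorusFactor {k : Type u} [Field k] {N : Type u} [AddCommGroup N] [Module.Free ℤ N]
    [Module.Finite ℤ N] {F : Fan N} {u : Module.Dual ℤ N} (hu : F.IsNull u) (hu0 : u ≠ 0) :
    HasTorusFactor k F := by
  obtain ⟨N₁, N₂, _, _, _, _, _, _, S, hN, hS⟩ := exists_splitting u hu0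
  have hF : ∀ σ ∈ F.cones, ∀ x ∈ σ, S.q x = 0 := fun σ hσ x hx => hS x (hu σ hσ x hx)
  exact ⟨N₁, N₂, inferInstance, inferInstance, inferInstance, inferInstance, inferInstance,
    inferInstance, S.fan hF, S.torusIso k, S.toricVarietyIso hF k, hN, inferInstance,
    S.torusAct_toricVarietyIso hF k⟩

end

end Toric

/-- Over any field `k`, for every fan `Σ` in a lattice `N` of finite rank other than the trivial fan
`{0}` in a lattice of rank one (that is, for every split toric variety `X_Σ` other than `𝔾ₘ`):
`X_Σ` has no torus factor if and only if `Aut_Σ` is finite. -/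
theorem lemma4p1 {k : Type u} [Field k] {N : Type u} [AddCommGroup N] [Module.Free ℤ N]
    [Module.Finite ℤ N] (F : Toric.Fan N)
    (hF : ¬ (Module.finrank ℤ N = 1 ∧ F.cones = {⊥})) :
    ¬ Toric.HasTorusFactor k F ↔ Finite F.aut := by
  -- Without non-zero null forms both sides hold; otherwise both fail.
  by_cases h : ∀ u, F.IsNull u → u = 0
  · exact iff_of_true (Toric.not_hasTorusFactor h) (F.finite_aut h)
  · push Not at h
    obtain ⟨u, hu, hu0⟩ := h
    exact iff_of_false (not_not_intro (Toric.hasTorusFactor hu hu0))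
      (not_finite_iff_infinite.2 (F.infinite_aut hF hu hu0))
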